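/- Let $R$ be an arbitrary commutative ring, $k\ge 0$ an integer, and $R[\mathbf{x}]=R[x_1,\dots,x_k]$ the polynomial ring with its usual multiplication and unity. Let $R[\mathbf{x};g]$ denote the $R$-bialgebra $R[\mathbf{x}]$ whose comultiplication and counit are the $R$-algebra homomorphisms with $\Delta_g(x_j)=x_j\otimes x_j$ and $\varepsilon_g(x_j)=1$, so that $\Delta_g(x_j^n)=x_j^n\otimes x_j^n$. Let $R[\mathbf{x};p]$ denote the Hopf $R$-algebra $R[\mathbf{x}]$ whose comultiplication, counit and antipode are the $R$-algebra homomorphisms with $\Delta_p(x_j)=x_j\otimes 1+1\otimes x_j$, $\varepsilon_p(x_j)=0$ and $S_p(x_j)=-x_j$, so that $\Delta_p(x_j^n)=\sum_{t=0}^n\binom nt x_j^t\otimes x_j^{n-t}$, $\varepsilon_p(x_j^n)=\delta_{n,0}$, $S_p(x_j^n)=(-1)^nx_j^n$. For a commutative $R$-algebra $A$ let $\mathcal{K}_A$ be the class of ideals $I$ of $A$ such that $A/I$ is a finitely generated $R$-module. $A$ is called cofinitary if $\mathcal{K}_A$ is a filter and every $I\in\mathcal{K}_A$ contains an ideal $\overline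 I$ of $A$ with $A/\overline I$ finitely generated and projective over $R$. If $\mathcal{K}_A$ is a filter, the finite dual of $A$ is $A^\circ=\{f\in \mathrm{Hom}_R(A,R)\mid f(I)=0\text{ for some }I\in\mathcal{K}_A\}$. A commutative $R$-bialgebra $H$ is called admissible if it is cofinitary and (A1) for all $I,J\in\mathcal{K}_H$ there is $L\in\mathcal{K}_H$ with $\Delta_H(L)\subseteq I\otimes_RH+H\otimes_RJ$ (the sum of the images in $H\otimes_R H$); (A2) there is $I\in\mathcal{K}_H$ with $I\subseteq\ker\varepsilon_H$. A commutative Hopf $R$-algebra $H$ is called admissible if it is admissible as an $R$-bialgebra and (A3) for every $I\in\mathcal{K}_H$ there is $J\in\mathcal{K}_H$ with $S_H(J)\subseteq I$. Then $R[\mathbf{x};g]$ is an admissible $R$-bialgebra and $R[\mathbf{x};p]$ is an admissible Hopf $R$-algebra. Hence $R[\mathbf{x};g]^\circ$ is an $R$-bialgebra and $R[\mathbf{x};p]^\circ$ is a Hopf $R$-algebra, with the dual structures. That is, for $H$ either of the two, $H^\circ$ is a subalgebra of $\mathrm{Hom}_R(H,R)$ with the convolution product and unity $\varepsilon_H$,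 and it carries an $R$-bialgebra structure on this algebra with counit $f\mapsto f(1)$ and with a comultiplication that sends each $f\in H^\circ$ to an element $\sum_i f_i\otimes f_i'\in H^\circ\otimes_RH^\circ$ such that $f(ab)=\sum_i f_i(a)f_i'(b)$ for all $a,b\in H$; for $H=R[\mathbf{x};p]$ this is moreover a Hopf $R$-algebra with antipode $f\mapsto f\circ S_p$. -/

import Mathlib

open scoped TensorProduct

universe u v

/-! ### Cofinite ideals, cofinitary algebras, finite duals -/

section Cofinite

variable (R : Type u) (A : Type v) [CommRing R] [CommRing A] [Algebra R A]

/-- The class `𝒦_A` of `R`-cofinite ideals of a commutative `R`-algebra `A`: the ideals `I` such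
that `A / I` is finitely generated as an `R`-module. -/
def cofiniteIdeals : Set (Ideal A) :=
  {I | Module.Finite R (A ⧸ I)}

/-- `A` is cofinitary if `𝒦_A` is a filter of ideals and every `I ∈ 𝒦_A` contains an ideal `J` with
`A / J` finitely generated and projective over `R`. -/
structure IsCofinitary : Prop where
  isPFilter : Order.IsPFilter (cofiniteIdeals R A)
  exists_projective : ∀ I ∈ cofiniteIdeals R A,
    ∃ J : Ideal A, J ≤ I ∧ Module.Finite R (A ⧸ J) ∧ Module.Projective R (A ⧸ J)

variable {R A} in
/-- The finite dual `A°` of an algebra `A` for which `𝒦_A` is a filter: all linear forms on `A`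
that vanish on some `R`-cofinite ideal. -/
def finiteDual (hA : Order.IsPFilter (cofiniteIdeals R A)) : Submodule R (Module.Dual R A) where
  carrier := {f | ∃ I ∈ cofiniteIdeals R A, ∀ a ∈ I, f a = 0}
  zero_mem' := by
    obtain ⟨I, hI⟩ := hA.Nonempty
    exact ⟨I, hI, fun _ _ => rfl⟩
  add_mem' := by
    rintro f g ⟨I, hI, hf⟩ ⟨J, hJ, hg⟩
    obtain ⟨L, hL, hLI, hLJ⟩ := hA.Directed I hI J hJ
    refine ⟨L, hL, fun a ha => ?_⟩
    rw [LinearMap.add_apply, hf a (hLI ha), hg a (hLJ ha), add_zero]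
  smul_mem' := by
    rintro r f ⟨I, hI, hf⟩
    refine ⟨I, hI, fun a ha => ?_⟩
    rw [LinearMap.smul_apply, hf a ha, smul_zero]

end Cofinite

/-! ### Admissible bialgebras and admissible Hopf algebras -/

section Admissible

open Coalgebra

/-- The submodule `I ⊗ H + H ⊗ J` of `H ⊗ H` (sum of the images of `I ⊗ H` and `H ⊗ J`). -/
def tensorSum (R : Type u) {H : Type v} [CommRing R] [CommRing H] [Algebra R H]
    (I J : Ideal H) : Submodule R (H ⊗[R] H) :=
  Submodule.span R ({t | ∃ a ∈ I, ∃ b : H, t = a ⊗ₜ[R] b} ∪ {t | ∃ a : H, ∃ b ∈ J, t = a ⊗ₜ[R] b})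

/-- A (commutative) `R`-bialgebra `H` is admissible if it is cofinitary and satisfies
(A1) for all `I, J ∈ 𝒦_H` there is `L ∈ 𝒦_H` with `Δ(L) ⊆ I ⊗ H + H ⊗ J`;
(A2) there is `I ∈ 𝒦_H` with `I ⊆ Ke(ε)`. -/
structure IsAdmissibleBialgebra (R : Type u) (H : Type v) [CommRing R] [CommRing H]
    [Bialgebra R H] : Prop extends IsCofinitary R H where
  exists_comul_mem : ∀ I ∈ cofiniteIdeals R H, ∀ J ∈ cofiniteIdeals R H,
    ∃ L ∈ cofiniteIdeals R H, ∀ a ∈ L, comul (R := R) a ∈ tensorSum R I J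
  exists_le_ker_counit : ∃ I ∈ cofiniteIdeals R H, ∀ a ∈ I, counit (R := R) a = 0

/-- A (commutative) Hopf `R`-algebra `H` is admissible if it is admissible as a bialgebra and
(A3) for every `I ∈ 𝒦_H` there is `J ∈ 𝒦_H` with `S(J) ⊆ I`. -/
structure IsAdmissibleHopfAlgebra (R : Type u) (H : Type v) [CommRing R] [CommRing H]
    [HopfAlgebra R H] : Prop extends IsAdmissibleBialgebra R H where
  exists_antipode_mem : ∀ I ∈ cofiniteIdeals R H,
    ∃ J ∈ cofiniteIdeals R H, ∀ a ∈ J, HopfAlgebra.antipode R a ∈ I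

variable {R : Type u} {H : Type v} [CommRing R] [CommRing H]

/-- For an admissible bialgebra `H`, the finite dual `H°` is a subalgebra of the dual algebra
`H* = Hom_R(H, R)`, whose product is the convolution product and whose unity is `ε`. -/
def finiteDualSubalgebra [Bialgebra R H] (h : IsAdmissibleBialgebra R H) :
    Subalgebra R (WithConv (H →ₗ[R] R)) where
  carrier := {f | f.ofConv ∈ finiteDual h.isPFilter}
  add_mem' := fun hf hg => (finiteDual h.isPFilter).add_mem hf hg
  mul_mem' := by
    rintro f g ⟨I, hI, hf⟩ ⟨J, hJ, hg⟩
    obtain ⟨L, hL, hLIJ⟩ := h.exists_comul_mem I hI J hJ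
    refine ⟨L, hL, fun a ha => ?_⟩
    rw [LinearMap.convMul_apply]
    have key : tensorSum R I J ≤
        LinearMap.ker (LinearMap.mul' R R ∘ₗ TensorProduct.map f.ofConv g.ofConv) := by
      refine Submodule.span_le.2 ?_
      rintro _ (⟨a, ha, b, rfl⟩ | ⟨a, b, hb, rfl⟩)
      · simp [hf a ha]
      · simp [hg b hb]
    exact key (hLIJ a ha)
  algebraMap_mem' := by
    intro r
    obtain ⟨I, hI, hε⟩ := h.exists_le_ker_counit
    refine ⟨I, hI, fun a ha => ?_⟩
    rw [LinearMap.convAlgebraMap_apply, hε a ha, map_zero, smul_zero]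

/-- The finite dual `H°` of an admissible bialgebra, as a type. -/
def FiniteDual [Bialgebra R H] (h : IsAdmissibleBialgebra R H) : Type (max u v) :=
  finiteDualSubalgebra h

namespace FiniteDual

variable [Bialgebra R H] (h : IsAdmissibleBialgebra R H)

/-- The ring structure of `H°`: pointwise addition, convolution product, unity `ε`. -/
noncomputable instance : Ring (FiniteDual h) :=
  inferInstanceAs (Ring (finiteDualSubalgebra h))

/-- Elements of `H°` are functions on `H`. -/
instance : CoeFun (FiniteDual h) (fun _ => H → R) where
  coe f := f.1.ofConv

/-- The predicate that a bialgebra structure on the ring `H°` is the one dual to the bialgebra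
structure of `H`: scalars act pointwise, the counit is `η° : f ↦ f 1`, and the comultiplication
`μ°` is dual to the multiplication of `H`, i.e. `μ°(f) = ∑ xᵢ ⊗ yᵢ` with
`f (a b) = ∑ xᵢ(a) yᵢ(b)` for all `a, b ∈ H`. (The product and the unity, dual to the
comultiplication and the counit of `H`, are already fixed by the ring structure of `H°`.) -/
structure IsDualBialgebra (B : Bialgebra R (FiniteDual h)) : Prop where
  smul_apply : ∀ (r : R) (f : FiniteDual h) (a : H), (r • f) a = r * f a
  counit_apply : ∀ f : FiniteDual h, counit (R := R) f = f 1
  comul_apply : ∀ f : FiniteDual h, ∃ (n : ℕ) (x y : Fin n → FiniteDual h),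
    comul (R := R) f = ∑ i, x i ⊗ₜ[R] y i ∧ ∀ a b : H, f (a * b) = ∑ i, x i a * y i b

end FiniteDual

/-- The predicate that a Hopf algebra structure on the ring `H°` is the one dual to the Hopf
algebra structure of `H`: moreover the antipode is `f ↦ f ∘ S`. -/
structure FiniteDual.IsDualHopfAlgebra [HopfAlgebra R H] (h : IsAdmissibleBialgebra R H)
    (B : HopfAlgebra R (FiniteDual h)) : Prop
    extends FiniteDual.IsDualBialgebra h B.toBialgebra where
  antipode_apply : ∀ (f : FiniteDual h) (a : H),
    (HopfAlgebra.antipode R f) a = f (HopfAlgebra.antipode R a)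

end Admissible

/-! ### The two coalgebra structures on the polynomial ring in `k` variables -/

/-- `R[x;g]`: the polynomial ring `R[x₁, …, x_k]`, i.e. the monoid algebra of the free commutative
monoid on `x₁, …, x_k`, with Mathlib's bialgebra structure on monoid algebras, in which all
monomials are group-like. -/
abbrev GroupLikePolynomial (R : Type u) [CommRing R] (k : ℕ) : Type u :=
  MvPolynomial (Fin k) R

/-- `R[x;p]`: the polynomial ring `R[x₁, …, x_k]`, to be equipped with the Hopf algebra structure
in which the variables are primitive. -/
def PrimitivePolynomial (R : Type u) [CommRing R] (k : ℕ) : Type u :=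
  MvPolynomial (Fin k) R

namespace GroupLikePolynomial

variable (R : Type u) [CommRing R] (k : ℕ)

theorem comul_X_pow (j : Fin k) (n : ℕ) :
    Coalgebra.comul (R := R) (MvPolynomial.X j ^ n : GroupLikePolynomial R k) =
      (MvPolynomial.X j ^ n) ⊗ₜ[R] (MvPolynomial.X j ^ n) := by
  rw [Bialgebra.comul_pow, MvPolynomial.X, MvPolynomial.monomial]
  simp [Algebra.TensorProduct.tmul_pow]

theorem counit_X_pow (j : Fin k) (n : ℕ) :
    Coalgebra.counit (R := R) (MvPolynomial.X j ^ n : GroupLikePolynomial R k) = 1 := by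
  rw [Bialgebra.counit_pow, MvPolynomial.X, MvPolynomial.monomial]
  simp

end GroupLikePolynomial

namespace PrimitivePolynomial

variable (R : Type u) [CommRing R] (k : ℕ)

noncomputable instance : CommRing (PrimitivePolynomial R k) :=
  inferInstanceAs (CommRing (MvPolynomial (Fin k) R))

/-- The usual `R`-algebra structure of the polynomial ring. -/
noncomputable instance : Algebra R (PrimitivePolynomial R k) :=
  inferInstanceAs (Algebra R (MvPolynomial (Fin k) R))

variable {k}

/-- The variable `x_j`. -/
noncomputable def X (j : Fin k) : PrimitivePolynomial R k :=
  (MvPolynomial.X j : MvPolynomial (Fin k) R)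

/-- The evaluation homomorphism sending `x_j` to `s j`. -/
noncomputable def eval {B : Type v} [CommRing B] [Algebra R B] (s : Fin k → B) :
    PrimitivePolynomial R k →ₐ[R] B :=
  (MvPolynomial.aeval s : MvPolynomial (Fin k) R →ₐ[R] B)

@[simp]
theorem eval_X {B : Type v} [CommRing B] [Algebra R B] (s : Fin k → B) (j : Fin k) :
    eval R s (X R j) = s j :=
  MvPolynomial.aeval_X s j

variable {R} in
theorem algHom_ext {B : Type v} [Semiring B] [Algebra R B]
    {f g : PrimitivePolynomial R k →ₐ[R] B} (h : ∀ j, f (X R j) = g (X R j)) : f = g :=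
  have key : ∀ f g : MvPolynomial (Fin k) R →ₐ[R] B,
      (∀ j, f (MvPolynomial.X j) = g (MvPolynomial.X j)) → f = g :=
    fun _ _ => MvPolynomial.algHom_ext
  key f g h

variable (k)

/-- The bialgebra structure on `R[x;p]`: `Δ_p` and `ε_p` are the algebra homomorphisms with
`Δ_p(x_j) = x_j ⊗ 1 + 1 ⊗ x_j` and `ε_p(x_j) = 0`. -/
noncomputable instance : Bialgebra R (PrimitivePolynomial R k) :=
  Bialgebra.ofAlgHom
    (eval R fun j => X R j ⊗ₜ[R] 1 + 1 ⊗ₜ[R] X R j)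
    (eval R fun _ => 0)
    (by
      refine algHom_ext fun j => ?_
      simp [Algebra.TensorProduct.one_def, TensorProduct.add_tmul, TensorProduct.tmul_add]
      abel)
    (algHom_ext fun j => by simp)
    (algHom_ext fun j => by simp)

variable {k}

@[simp]
theorem comul_X (j : Fin k) :
    Coalgebra.comul (R := R) (X R j) = X R j ⊗ₜ[R] 1 + 1 ⊗ₜ[R] X R j :=
  eval_X R _ j

@[simp]
theorem counit_X (j : Fin k) : Coalgebra.counit (R := R) (X R j) = 0 :=
  eval_X R (B := R) _ j

theorem comul_X_pow (j : Fin k) (n : ℕ) :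
    Coalgebra.comul (R := R) (X R j ^ n) =
      ∑ t ∈ Finset.range (n + 1), n.choose t • (X R j ^ t) ⊗ₜ[R] (X R j ^ (n - t)) := by
  rw [Bialgebra.comul_pow, comul_X, (Commute.all _ _).add_pow]
  refine Finset.sum_congr rfl fun t _ => ?_
  simp [Algebra.TensorProduct.tmul_pow, mul_comm, nsmul_eq_mul]

theorem counit_X_pow (j : Fin k) (n : ℕ) :
    Coalgebra.counit (R := R) (X R j ^ n) = if n = 0 then 1 else 0 := by
  rw [Bialgebra.counit_pow, counit_X, zero_pow_eq]

variable (k)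

/-- The Hopf algebra structure on `R[x;p]`: the antipode `S_p` is the algebra homomorphism with
`S_p(x_j) = -x_j`. -/
noncomputable instance : HopfAlgebra R (PrimitivePolynomial R k) where
  antipode := (eval R fun j => -X R j).toLinearMap
  mul_antipode_rTensor_comul := by
    let F := Algebra.TensorProduct.lift (eval R fun j => -X R j) (AlgHom.id R (PrimitivePolynomial R k))
      fun _ _ => Commute.all _ _
    have key : F.comp (Bialgebra.comulAlgHom R (PrimitivePolynomial R k)) =
        (Algebra.ofId R _).comp (Bialgebra.counitAlgHom R _) :=
      algHom_ext fun j => by simp [F]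
    have aux : LinearMap.mul' R _ ∘ₗ LinearMap.rTensor _ (eval R fun j => -X R j).toLinearMap =
        F.toLinearMap := by
      ext
      simp [F]
    exact LinearMap.ext fun a => (LinearMap.congr_fun aux (Coalgebra.comul a)).trans
      (DFunLike.congr_fun key a)
  mul_antipode_lTensor_comul := by
    let F := Algebra.TensorProduct.lift (AlgHom.id R (PrimitivePolynomial R k)) (eval R fun j => -X R j)
      fun _ _ => Commute.all _ _
    have key : F.comp (Bialgebra.comulAlgHom R (PrimitivePolynomial R k)) =
        (Algebra.ofId R _).comp (Bialgebra.counitAlgHom R _) :=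
      algHom_ext fun j => by simp [F]
    have aux : LinearMap.mul' R _ ∘ₗ LinearMap.lTensor _ (eval R fun j => -X R j).toLinearMap =
        F.toLinearMap := by
      ext
      simp [F]
    exact LinearMap.ext fun a => (LinearMap.congr_fun aux (Coalgebra.comul a)).trans
      (DFunLike.congr_fun key a)

theorem antipode_X_pow {k : ℕ} (j : Fin k) (n : ℕ) :
    HopfAlgebra.antipode R (X R j ^ n) = (-1) ^ n * X R j ^ n := by
  change eval R (fun j => -X R j) (X R j ^ n) = _
  rw [map_pow, eval_X, neg_pow]

end PrimitivePolynomial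

/-! Over any commutative ring, an algebra that is integral and of finite type is module-finite. So
for `A` of finite type, every algebra homomorphism from `A` to a module-finite algebra has cofinite
kernel (`ker_mem_cofiniteIdeals`). The filter property and (A1)-(A3) all reduce to this, and only
projectivity remains: modulo a cofinite `I` each variable is a root of a monic `p_j`, and the ideal
of all `p_j(x_j)` lies in `I` and has a finite projective quotient.

For the dual structure, a finite projective quotient yields finitely many `e i` in `H` and `E i` in
`H°` with `f = ∑ f (e i) • E i` for all `f` vanishing on `I` (`exists_dualBasis`). Hence tensors in
`H° ⊗ M` are determined by evaluating the first factor (`tensor_ext`). The comultiplication is then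
the unique map whose evaluation at `a` is `f ↦ f(a ·)`, and every axiom is checked by evaluating. -/

section Cofinite

/-! ### Cofinite ideals in algebras of finite type. -/

variable {R : Type u} {A : Type v} [CommRing R] [CommRing A] [Algebra R A]

/-- The kernel of a homomorphism from an algebra of finite type to a finite algebra is cofinite. -/
theorem ker_mem_cofiniteIdeals [Algebra.FiniteType R A] {C : Type*} [CommRing C] [Algebra R C]
    [Module.Finite R C] (φ : A →ₐ[R] C) : RingHom.ker φ ∈ cofiniteIdeals R A := by
  -- The quotient embeds in the finite algebra `C`, so it is integral; a submodule of `C` need not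
  -- be finite, hence the use of finite type.
  have : Algebra.IsIntegral R (A ⧸ RingHom.ker φ) :=
    Algebra.IsIntegral.of_injective (Ideal.kerLiftAlg φ) (Ideal.kerLiftAlg_injective φ)
  have : Algebra.FiniteType R (A ⧸ RingHom.ker φ) :=
    Algebra.FiniteType.of_surjective (Ideal.Quotient.mkₐ R _) (Ideal.Quotient.mkₐ_surjective R _)
  exact Algebra.IsIntegral.finite

theorem cofiniteIdeals_mem_of_le {I J : Ideal A} (hIJ : I ≤ J) (hI : I ∈ cofiniteIdeals R A) :
    J ∈ cofiniteIdeals R A :=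
  have : Module.Finite R (A ⧸ I) := hI
  Module.Finite.of_surjective (Ideal.Quotient.factorₐ R hIJ).toLinearMap
    (Ideal.Quotient.factor_surjective hIJ)

variable (R A) in
theorem isPFilter_cofiniteIdeals [Algebra.FiniteType R A] :
    Order.IsPFilter (cofiniteIdeals R A) := by
  refine Order.IsPFilter.of_def ⟨⊤, ?_⟩ ?_ cofiniteIdeals_mem_of_le
  · have : Subsingleton (A ⧸ (⊤ : Ideal A)) := Ideal.Quotient.subsingleton_iff.2 rfl
    exact Module.Finite.of_finite
  · intro I hI J hJ
    have : Module.Finite R (A ⧸ I) := hI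
    have : Module.Finite R (A ⧸ J) := hJ
    -- The kernel of `A → A/I × A/J` is `I ∩ J`.
    refine ⟨_, ker_mem_cofiniteIdeals
      ((Ideal.Quotient.mkₐ R I).prod (Ideal.Quotient.mkₐ R J)), fun a ha => ?_, fun a ha => ?_⟩
    · exact Ideal.Quotient.eq_zero_iff_mem.1 (congrArg Prod.fst ha)
    · exact Ideal.Quotient.eq_zero_iff_mem.1 (congrArg Prod.snd ha)

end Cofinite

section Admissible

/-! ### Admissibility from cofinitarity. -/

variable {R : Type u} {H : Type v} [CommRing R] [CommRing H]

/-- Right exactness of the tensor product. It turns (A1) into a statement about the kernel of `H →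
H/I ⊗ H/J`. -/
theorem ker_map_mkₐ_le_tensorSum [Algebra R H] (I J : Ideal H) :
    LinearMap.ker (TensorProduct.map (Ideal.Quotient.mkₐ R I).toLinearMap
      (Ideal.Quotient.mkₐ R J).toLinearMap) ≤ tensorSum R I J := by
  have hex : ∀ K : Ideal H, Function.Exact (K.restrictScalars R).subtype
      (Ideal.Quotient.mkₐ R K).toLinearMap := fun K a => by
    simp [Ideal.Quotient.eq_zero_iff_mem]
  rw [TensorProduct.map_ker (hex I) (Ideal.Quotient.mkₐ_surjective R I) (hex J)
    (Ideal.Quotient.mkₐ_surjective R J)]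
  refine sup_le ?_ ?_
  · rintro _ ⟨t, rfl⟩
    induction t with
    | zero => simp
    | add s t hs ht => rw [map_add]; exact add_mem hs ht
    | tmul a b => exact Submodule.subset_span (.inr ⟨a, b, b.2, rfl⟩)
  · rintro _ ⟨t, rfl⟩
    induction t with
    | zero => simp
    | add s t hs ht => rw [map_add]; exact add_mem hs ht
    | tmul a b => exact Submodule.subset_span (.inl ⟨a, a.2, b, rfl⟩)

theorem IsCofinitary.isAdmissibleBialgebra [Bialgebra R H] [Algebra.FiniteType R H]
    (hH : IsCofinitary R H) : IsAdmissibleBialgebra R H where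
  toIsCofinitary := hH
  exists_comul_mem I hI J hJ := by
    have : Module.Finite R (H ⧸ I) := hI
    have : Module.Finite R (H ⧸ J) := hJ
    exact ⟨_, ker_mem_cofiniteIdeals ((Algebra.TensorProduct.map (Ideal.Quotient.mkₐ R I)
      (Ideal.Quotient.mkₐ R J)).comp (Bialgebra.comulAlgHom R H)),
      fun a ha => ker_map_mkₐ_le_tensorSum I J ha⟩
  exists_le_ker_counit :=
    ⟨_, ker_mem_cofiniteIdeals (Bialgebra.counitAlgHom R H), fun _ ha => ha⟩

theorem IsCofinitary.isAdmissibleHopfAlgebra [HopfAlgebra R H] [Algebra.FiniteType R H]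
    (hH : IsCofinitary R H) : IsAdmissibleHopfAlgebra R H where
  toIsAdmissibleBialgebra := hH.isAdmissibleBialgebra
  exists_antipode_mem I hI := by
    have : Module.Finite R (H ⧸ I) := hI
    -- Since `H` is commutative, its antipode is an algebra homomorphism.
    exact ⟨_, ker_mem_cofiniteIdeals
      ((Ideal.Quotient.mkₐ R I).comp (HopfAlgebra.antipodeAlgHom R H)),
      fun a ha => Ideal.Quotient.eq_zero_iff_mem.1 ha⟩

end Admissible

/-! ### Polynomial rings are cofinitary. -/

namespace MvPolynomial

variable {R : Type u} [CommRing R]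

/-- A finite projective algebra with a universal family of roots of given monic polynomials. -/
theorem exists_universal_roots {k : ℕ} (p : Fin k → Polynomial R) (hp : ∀ j, (p j).Monic) :
    ∃ (B : Type u) (_ : CommRing B) (_ : Algebra R B) (s : Fin k → B),
      Module.Finite R B ∧ Module.Projective R B ∧ (∀ j, Polynomial.aeval (s j) (p j) = 0) ∧
      ∀ (C : Type u) [CommRing C] [Algebra R C] (t : Fin k → C),
        (∀ j, Polynomial.aeval (t j) (p j) = 0) → ∃ φ : B →ₐ[R] C, ∀ j, φ (s j) = t j := by
  induction k with
  | zero =>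
    exact ⟨R, inferInstance, inferInstance, Fin.elim0, inferInstance, inferInstance,
      fun j => j.elim0, fun C _ _ t _ => ⟨Algebra.ofId R C, fun j => j.elim0⟩⟩
  | succ k ih =>
    obtain ⟨B, _, _, s, _, _, hs, hB⟩ := ih (fun j => p j.succ) fun j => hp _
    have := (hp 0).free_adjoinRoot
    have := (hp 0).finite_adjoinRoot
    -- Each tensor factor adjoins one root; it is free of finite rank because `p 0` is monic.
    refine ⟨AdjoinRoot (p 0) ⊗[R] B, inferInstance, inferInstance,
      Fin.cons (AdjoinRoot.root (p 0) ⊗ₜ 1) fun j => 1 ⊗ₜ s j, inferInstance, inferInstance,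
      fun j => ?_, fun C _ _ t ht => ?_⟩
    · refine Fin.cases ?_ (fun j => ?_) j
      · have := Polynomial.aeval_algHom_apply
          (Algebra.TensorProduct.includeLeft : AdjoinRoot (p 0) →ₐ[R] AdjoinRoot (p 0) ⊗[R] B)
          (AdjoinRoot.root (p 0)) (p 0)
        simpa using this
      · have := Polynomial.aeval_algHom_apply
          (Algebra.TensorProduct.includeRight : B →ₐ[R] AdjoinRoot (p 0) ⊗[R] B) (s j) (p j.succ)
        simpa [hs] using this
    · obtain ⟨φ, hφ⟩ := hB C (fun j => t j.succ) fun j => ht _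
      refine ⟨Algebra.TensorProduct.lift (AdjoinRoot.liftAlgHom (p 0) (Algebra.ofId R C) (t 0)
        (ht 0)) φ fun _ _ => Commute.all _ _, fun j => ?_⟩
      refine Fin.cases ?_ (fun j => ?_) j
      · simpa using AdjoinRoot.liftAlgHom_root (p 0) (Algebra.ofId R C) (t 0) (ht 0)
      · simp [hφ]

/-- The quotient is a retract of the universal algebra `B`: evaluation at the roots maps it to `B`,
and the universal property maps back. No isomorphism with `B` is needed. -/
theorem finite_projective_quotient_span_aeval {k : ℕ} (p : Fin k → Polynomial R)
    (hp : ∀ j, (p j).Monic) :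
    let J : Ideal (MvPolynomial (Fin k) R) :=
      Ideal.span (Set.range fun j => Polynomial.aeval (X j) (p j))
    Module.Finite R (MvPolynomial (Fin k) R ⧸ J) ∧
      Module.Projective R (MvPolynomial (Fin k) R ⧸ J) := by
  intro J
  obtain ⟨B, _, _, s, _, _, hs, hB⟩ := exists_universal_roots p hp
  have hX : ∀ j, Polynomial.aeval (Ideal.Quotient.mkₐ R J (X j)) (p j) = 0 := fun j => by
    rw [Polynomial.aeval_algHom_apply]
    exact Ideal.Quotient.eq_zero_iff_mem.2 (Ideal.subset_span ⟨j, rfl⟩)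
  obtain ⟨φ, hφ⟩ := hB _ _ hX
  have hJ : ∀ a ∈ J, aeval s a = 0 := by
    change J ≤ RingHom.ker (aeval s)
    refine Ideal.span_le.2 ?_
    rintro _ ⟨j, rfl⟩
    change aeval s (Polynomial.aeval (X j) (p j)) = 0
    rw [← Polynomial.aeval_algHom_apply, aeval_X, hs]
  have hcomp : φ.comp (Ideal.Quotient.liftₐ J (aeval s) hJ) = AlgHom.id R _ := by
    refine Ideal.Quotient.algHom_ext _ (MvPolynomial.algHom_ext fun j => ?_)
    exact (congrArg φ (aeval_X (R := R) s j)).trans (hφ j)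
  have hlin : φ.toLinearMap ∘ₗ (Ideal.Quotient.liftₐ J (aeval s) hJ).toLinearMap =
      LinearMap.id := congrArg AlgHom.toLinearMap hcomp
  exact ⟨Module.Finite.of_surjective φ.toLinearMap fun a => ⟨_, LinearMap.congr_fun hlin a⟩,
    Module.Projective.of_split _ _ hlin⟩

variable (R) in
theorem isCofinitary (k : ℕ) : IsCofinitary R (MvPolynomial (Fin k) R) where
  isPFilter := isPFilter_cofiniteIdeals R _
  exists_projective I hI := by
    have : Module.Finite R (MvPolynomial (Fin k) R ⧸ I) := hI
    -- A finite quotient is integral, so each variable satisfies a monic equation modulo `I`.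
    choose p hp hp0 using fun j : Fin k =>
      Algebra.IsIntegral.isIntegral (R := R) (Ideal.Quotient.mkₐ R I (X j))
    refine ⟨_, Ideal.span_le.2 ?_, finite_projective_quotient_span_aeval p hp⟩
    rintro _ ⟨j, rfl⟩
    have := hp0 j
    rw [← Polynomial.aeval_def, Polynomial.aeval_algHom_apply] at this
    exact Ideal.Quotient.eq_zero_iff_mem.1 this

end MvPolynomial

/-- Cofinitarity depends only on the algebra structure, which is that of `MvPolynomial`. -/
theorem PrimitivePolynomial.isCofinitary (R : Type u) [CommRing R] (k : ℕ) :
    IsCofinitary R (PrimitivePolynomial R k) :=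
  MvPolynomial.isCofinitary R k

instance PrimitivePolynomial.finiteType (R : Type u) [CommRing R] (k : ℕ) :
    Algebra.FiniteType R (PrimitivePolynomial R k) :=
  inferInstanceAs (Algebra.FiniteType R (MvPolynomial (Fin k) R))

/-! ### The dual bialgebra and Hopf algebra structures. -/

namespace FiniteDual

open Coalgebra

section Bialgebra

variable {R : Type u} {H : Type v} [CommRing R] [CommRing H] [Bialgebra R H]
  {h : IsAdmissibleBialgebra R H}

noncomputable instance : Algebra R (FiniteDual h) :=
  inferInstanceAs (Algebra R (finiteDualSubalgebra h))

@[ext]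
theorem ext {f g : FiniteDual h} (hfg : ∀ a, f a = g a) : f = g :=
  Subtype.ext (WithConv.ofConv_injective (LinearMap.ext hfg))

/-- The element of `H°` given by a linear form vanishing on a cofinite ideal. -/
def mk (φ : H →ₗ[R] R) (hφ : ∃ I ∈ cofiniteIdeals R H, ∀ a ∈ I, φ a = 0) : FiniteDual h :=
  ⟨WithConv.toConv φ, hφ⟩

@[simp]
theorem mk_apply (φ : H →ₗ[R] R) (hφ) (a : H) : (mk φ hφ : FiniteDual h) a = φ a := rfl

theorem exists_vanishing (f : FiniteDual h) : ∃ I ∈ cofiniteIdeals R H, ∀ a ∈ I, f a = 0 := f.2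

theorem one_apply (a : H) : (1 : FiniteDual h) a = counit (R := R) a := rfl

theorem algebraMap_apply (r : R) (a : H) :
    (algebraMap R (FiniteDual h) r) a = r * counit (R := R) a := rfl

theorem mul_apply (f g : FiniteDual h) {a : H} {ι : Type*} (r : Coalgebra.Repr R a ι) :
    (f * g) a = ∑ i ∈ r.index, f (r.left i) * g (r.right i) :=
  r.convMul_apply f.1 g.1

variable (h) in
/-- Evaluation of elements of `H°` at a point of `H`. -/
def ev (a : H) : FiniteDual h →ₗ[R] R where
  toFun f := f a
  map_add' _ _ := rfl
  map_smul' _ _ := rfl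

@[simp]
theorem ev_apply (a : H) (f : FiniteDual h) : ev h a f = f a := rfl

/-- The translate `f(a ·)` of `f ∈ H°`. -/
def translate (a : H) : FiniteDual h →ₗ[R] FiniteDual h where
  toFun f := mk (f.1.ofConv ∘ₗ LinearMap.mulLeft R a) <| by
    obtain ⟨I, hI, hf⟩ := f.exists_vanishing
    exact ⟨I, hI, fun b hb => hf _ (I.mul_mem_left a hb)⟩
  map_add' _ _ := rfl
  map_smul' _ _ := rfl

@[simp]
theorem translate_apply (a b : H) (f : FiniteDual h) : translate a f b = f (a * b) := rfl

variable {M N : Type*} [AddCommGroup M] [Module R M] [AddCommGroup N] [Module R N]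

variable (h M) in
/-- Evaluation of the first factor of `H° ⊗ M` at a point of `H`. -/
noncomputable def evLeft (a : H) : FiniteDual h ⊗[R] M →ₗ[R] M :=
  TensorProduct.lid R M ∘ₗ (ev h a).rTensor M

@[simp]
theorem evLeft_tmul (a : H) (f : FiniteDual h) (m : M) : evLeft h M a (f ⊗ₜ m) = f a • m := rfl

/-- Every cofinite ideal contains one modulo which `H°` has a dual basis. -/
theorem exists_dualBasis (h : IsAdmissibleBialgebra R H) {I : Ideal H}
    (hI : I ∈ cofiniteIdeals R H) :
    ∃ (n : ℕ) (e : Fin n → H) (E : Fin n → FiniteDual h),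
      ∀ f : FiniteDual h, (∀ a ∈ I, f a = 0) → f = ∑ i, f (e i) • E i := by
  obtain ⟨J, hJI, hJ, _⟩ := h.exists_projective I hI
  -- `q` splits the surjection `p : R^n → H/J`. The `e i` lift the images of the standard basis, and
  -- the `E i` are the coordinates of `q`.
  obtain ⟨n, p, q, -, -, hpq⟩ := Module.Finite.exists_comp_eq_id_of_projective R (H ⧸ J)
  choose e he using fun i => Ideal.Quotient.mk_surjective (p fun j => if i = j then 1 else 0)
  let π : H →ₗ[R] H ⧸ J := (Ideal.Quotient.mkₐ R J).toLinearMap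
  refine ⟨n, e, fun i => mk (LinearMap.proj i ∘ₗ q ∘ₗ π)
    ⟨J, hJ, fun a ha => ?_⟩, fun f hf => ?_⟩
  · have : π a = 0 := Ideal.Quotient.eq_zero_iff_mem.2 ha
    simp [this]
  · ext a
    have hmem : a - ∑ i, q (π a) i • e i ∈ J := by
      have hπ : π (a - ∑ i, q (π a) i • e i) = 0 := by
        have he' : ∀ i, π (e i) = p fun j => if i = j then 1 else 0 := he
        have := LinearMap.congr_fun hpq (π a)
        rw [LinearMap.comp_apply, LinearMap.id_apply] at this
        simp only [map_sub, map_sum, map_smul, he']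
        conv_lhs => enter [1]; rw [← this]
        rw [sub_eq_zero, p.pi_apply_eq_sum_univ]
      exact Ideal.Quotient.eq_zero_iff_mem.1 hπ
    have h0 := hf _ (hJI hmem)
    rw [map_sub, sub_eq_zero] at h0
    rw [h0, ← ev_apply (h := h) a (∑ i, _)]
    simp [mul_comm, π]

/-- Elements of `H° ⊗ M` are determined by evaluating the first factor. -/
theorem tensor_ext {s t : FiniteDual h ⊗[R] M} (hst : ∀ a, evLeft h M a s = evLeft h M a t) :
    s = t := by
  -- Quantifying over all dual bases for `I` lets the claim pass to smaller ideals, as the sum of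
  -- two tensors requires.
  have key : ∀ t : FiniteDual h ⊗[R] M, ∃ I ∈ cofiniteIdeals R H,
      ∀ (n : ℕ) (e : Fin n → H) (E : Fin n → FiniteDual h),
        (∀ f : FiniteDual h, (∀ a ∈ I, f a = 0) → f = ∑ i, f (e i) • E i) →
        t = ∑ i, E i ⊗ₜ[R] evLeft h M (e i) t := by
    intro t
    induction t with
    | zero =>
      obtain ⟨I, hI⟩ := h.isPFilter.Nonempty
      exact ⟨I, hI, fun n e E _ => by simp⟩
    | tmul f m =>
      obtain ⟨I, hI, hf⟩ := f.exists_vanishing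
      refine ⟨I, hI, fun n e E hE => ?_⟩
      conv_lhs => rw [hE f hf]
      simp [TensorProduct.sum_tmul, TensorProduct.smul_tmul]
    | add s t hs ht =>
      obtain ⟨I, hI, hs⟩ := hs
      obtain ⟨J, hJ, ht⟩ := ht
      obtain ⟨L, hL, hLI, hLJ⟩ := h.isPFilter.Directed I hI J hJ
      refine ⟨L, hL, fun n e E hE => ?_⟩
      conv_lhs => rw [hs n e E fun f hf => hE f fun a ha => hf a (hLI ha),
        ht n e E fun f hf => hE f fun a ha => hf a (hLJ ha)]
      simp [TensorProduct.tmul_add, Finset.sum_add_distrib]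
  obtain ⟨I, hI, hIt⟩ := key (s - t)
  obtain ⟨n, e, E, hE⟩ := exists_dualBasis h hI
  rw [← sub_eq_zero, hIt n e E hE]
  simp [hst]

theorem evLeft_lTensor (g : M →ₗ[R] N) (a : H) (t : FiniteDual h ⊗[R] M) :
    evLeft h N a (g.lTensor _ t) = g (evLeft h M a t) := by
  induction t with
  | zero => simp
  | tmul f m => simp
  | add s t hs ht => simp [hs, ht]

theorem evLeft_rTensor_translate (a b : H) (t : FiniteDual h ⊗[R] M) :
    evLeft h M b ((translate a).rTensor M t) = evLeft h M (a * b) t := by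
  induction t with
  | zero => simp
  | tmul f m => simp
  | add s t hs ht => simp [hs, ht]

theorem evLeft_assoc (a : H) (t : (FiniteDual h ⊗[R] N) ⊗[R] M) :
    evLeft h (N ⊗[R] M) a (TensorProduct.assoc R _ N M t) = (evLeft h N a).rTensor M t := by
  induction t with
  | zero => simp
  | tmul s m =>
    induction s with
    | zero => simp
    | tmul f x => simp [TensorProduct.smul_tmul']
    | add s t hs ht => simp_all [TensorProduct.add_tmul]
  | add s t hs ht => simp [hs, ht]

/-- Evaluation turns the product of tensors into a convolution; this serves the multiplicativity of
the comultiplication. -/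
theorem evLeft_mul {A : Type*} [Ring A] [Algebra R A] {a : H} {ι : Type*} (r : Coalgebra.Repr R a ι)
    (s t : FiniteDual h ⊗[R] A) :
    evLeft h A a (s * t) = ∑ i ∈ r.index, evLeft h A (r.left i) s * evLeft h A (r.right i) t := by
  induction s with
  | zero => simp
  | add s s' hs hs' => simp [add_mul, hs, hs', Finset.sum_add_distrib]
  | tmul f x =>
    induction t with
    | zero => simp
    | add s s' hs hs' => simp [mul_add, hs, hs', Finset.sum_add_distrib]
    | tmul g y =>
      simp [mul_apply f g r, Finset.sum_smul, smul_smul, mul_comm]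

theorem exists_dual_mul (f : FiniteDual h) :
    ∃ (n : ℕ) (x y : Fin n → FiniteDual h), ∀ a b : H, f (a * b) = ∑ i, x i a * y i b := by
  obtain ⟨I, hI, hf⟩ := f.exists_vanishing
  obtain ⟨n, e, E, hE⟩ := exists_dualBasis h hI
  refine ⟨n, E, fun i => translate (e i) f, fun a b => ?_⟩
  -- `f(b ·)` still vanishes on the ideal `I`, so it expands as `∑ f(b (e i)) • E i`.
  have := congrArg (ev h a) (hE (translate b f) fun a ha => hf _ (I.mul_mem_left b ha))
  simpa [mul_comm] using this

theorem evLeft_sum_tmul {n : ℕ} {x y : Fin n → FiniteDual h} {f : FiniteDual h}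
    (hf : ∀ a b : H, f (a * b) = ∑ i, x i a * y i b) (a : H) :
    evLeft h _ a (∑ i, x i ⊗ₜ[R] y i) = translate a f := by
  ext b
  rw [translate_apply, hf, ← ev_apply]
  simp

theorem exists_evLeft_eq_translate (f : FiniteDual h) :
    ∃ t : FiniteDual h ⊗[R] FiniteDual h, ∀ a, evLeft h _ a t = translate a f := by
  obtain ⟨n, x, y, hf⟩ := f.exists_dual_mul
  exact ⟨_, evLeft_sum_tmul hf⟩

/-- The comultiplication of `H°`, dual to the multiplication of `H`. -/
noncomputable def comulHom : FiniteDual h →ₗ[R] FiniteDual h ⊗[R] FiniteDual h where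
  -- By `tensor_ext` the chosen tensor is unique, which forces linearity.
  toFun f := f.exists_evLeft_eq_translate.choose
  map_add' f g := tensor_ext fun a => by
    rw [map_add, (exists_evLeft_eq_translate _).choose_spec,
      (exists_evLeft_eq_translate _).choose_spec, (exists_evLeft_eq_translate _).choose_spec,
      map_add]
  map_smul' r f := tensor_ext fun a => by
    rw [RingHom.id_apply, map_smul, (exists_evLeft_eq_translate _).choose_spec,
      (exists_evLeft_eq_translate _).choose_spec, map_smul]

@[simp]
theorem evLeft_comulHom (f : FiniteDual h) (a : H) : evLeft h _ a (comulHom f) = translate a f :=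
  f.exists_evLeft_eq_translate.choose_spec a

theorem comulHom_translate (a : H) (f : FiniteDual h) :
    comulHom (translate a f) = (translate a).rTensor _ (comulHom f) :=
  tensor_ext fun b => by
    ext c
    rw [evLeft_rTensor_translate, evLeft_comulHom, evLeft_comulHom]
    simp [mul_assoc]

noncomputable instance : Coalgebra R (FiniteDual h) where
  comul := comulHom
  counit := ev h 1
  coassoc := LinearMap.ext fun f => tensor_ext fun a => by
    have hc : evLeft h _ a ∘ₗ comulHom = translate a := LinearMap.ext fun f => evLeft_comulHom f a
    simp only [LinearMap.comp_apply, LinearEquiv.coe_coe]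
    -- Evaluated at `a`, both sides become the comultiplication of `f` with its first factor
    -- translated by `a`.
    rw [evLeft_assoc, evLeft_lTensor, evLeft_comulHom, comulHom_translate,
      ← LinearMap.rTensor_comp_apply, hc]
  rTensor_counit_comp_comul := LinearMap.ext fun f => by
    apply (TensorProduct.lid R (FiniteDual h)).injective
    -- The counit is evaluation at `1`, so `lid` after it is `evLeft` at `1`.
    refine (evLeft_comulHom f 1).trans ?_
    ext a
    simp
  lTensor_counit_comp_comul := LinearMap.ext fun f => tensor_ext fun a => by
    rw [LinearMap.comp_apply, evLeft_lTensor, evLeft_comulHom]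
    simp

theorem comul_eq (f : FiniteDual h) : comul (R := R) f = comulHom f := rfl

theorem counit_eq (f : FiniteDual h) : counit (R := R) f = f 1 := rfl

noncomputable instance : Bialgebra R (FiniteDual h) :=
  Bialgebra.mk' R (FiniteDual h)
    (by rw [counit_eq, one_apply, Bialgebra.counit_one])
    (by
      intro f g
      have := mul_apply f g (a := 1)
        ⟨{()}, fun _ => 1, fun _ => 1, by simp [Algebra.TensorProduct.one_def]⟩
      simpa [counit_eq] using this)
    (tensor_ext fun a => by
      ext b
      rw [comul_eq, evLeft_comulHom, Algebra.TensorProduct.one_def, evLeft_tmul]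
      exact Bialgebra.counit_mul a b)
    (by
      intro f g
      refine tensor_ext fun a => ?_
      ext b
      rw [evLeft_mul (ℛ R a), comul_eq, evLeft_comulHom, ← ev_apply (h := h) b (∑ i ∈ _, _), map_sum]
      simp only [comul_eq, evLeft_comulHom, translate_apply, ev_apply]
      simp only [mul_apply _ _ (ℛ R b), translate_apply]
      -- Multiplying representations of `Δ a` and `Δ b` represents `Δ (a b)`; both sides are then `∑
      -- f(a₁ b₁) g(a₂ b₂)`.
      have hr : comul (R := R) (a * b) = ∑ i ∈ (ℛ R a).index ×ˢ (ℛ R b).index,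
          ((ℛ R a).left i.1 * (ℛ R b).left i.2) ⊗ₜ[R]
            ((ℛ R a).right i.1 * (ℛ R b).right i.2) := by
        rw [Bialgebra.comul_mul, ← (ℛ R a).eq, ← (ℛ R b).eq, Finset.sum_mul_sum,
          Finset.sum_product]
        simp
      rw [mul_apply f g ⟨_, _, _, hr.symm⟩, Finset.sum_product])

theorem isDualBialgebra (h : IsAdmissibleBialgebra R H) :
    IsDualBialgebra h (inferInstance : Bialgebra R (FiniteDual h)) where
  smul_apply _ _ _ := rfl
  counit_apply _ := rfl
  comul_apply f := by
    obtain ⟨n, x, y, hf⟩ := f.exists_dual_mul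
    exact ⟨n, x, y, tensor_ext fun a => (evLeft_comulHom f a).trans (evLeft_sum_tmul hf a).symm, hf⟩

end Bialgebra

/-! ### The antipode of the finite dual. -/

section HopfAlgebra

variable {R : Type u} {H : Type v} [CommRing R] [CommRing H] [HopfAlgebra R H]

/-- The antipode `f ↦ f ∘ S` of `H°`. -/
def antipodeHom (h : IsAdmissibleHopfAlgebra R H) :
    FiniteDual h.toIsAdmissibleBialgebra →ₗ[R] FiniteDual h.toIsAdmissibleBialgebra where
  toFun f := mk (f.1.ofConv ∘ₗ HopfAlgebra.antipode R) <| by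
    obtain ⟨I, hI, hf⟩ := f.exists_vanishing
    obtain ⟨J, hJ, hJI⟩ := h.exists_antipode_mem I hI
    exact ⟨J, hJ, fun a ha => hf _ (hJI a ha)⟩
  map_add' _ _ := rfl
  map_smul' _ _ := rfl

theorem antipodeHom_apply (h : IsAdmissibleHopfAlgebra R H)
    (f : FiniteDual h.toIsAdmissibleBialgebra) (a : H) :
    antipodeHom h f a = f (HopfAlgebra.antipode R a) := rfl

variable {h : IsAdmissibleHopfAlgebra R H}

/-- For `t = Δ f` the right side is `f (∑ S(a₁) a₂)`, so the antipode axiom of `H°` reduces to that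
of `H`. -/
theorem mul'_rTensor_antipodeHom_apply {a : H} {ι : Type*} (r : Coalgebra.Repr R a ι)
    (t : FiniteDual h.toIsAdmissibleBialgebra ⊗[R] FiniteDual h.toIsAdmissibleBialgebra) :
    (LinearMap.mul' R _ ((antipodeHom h).rTensor _ t)) a =
      ∑ i ∈ r.index, (evLeft _ _ (HopfAlgebra.antipode R (r.left i)) t) (r.right i) := by
  simp only [← ev_apply]
  induction t with
  | zero => simp only [map_zero, Finset.sum_const_zero]
  | tmul f g => simp [mul_apply _ _ r, antipodeHom_apply]
  | add s t hs ht => simp only [map_add, hs, ht, Finset.sum_add_distrib]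

theorem mul'_lTensor_antipodeHom_apply {a : H} {ι : Type*} (r : Coalgebra.Repr R a ι)
    (t : FiniteDual h.toIsAdmissibleBialgebra ⊗[R] FiniteDual h.toIsAdmissibleBialgebra) :
    (LinearMap.mul' R _ ((antipodeHom h).lTensor _ t)) a =
      ∑ i ∈ r.index, (evLeft _ _ (r.left i) t) (HopfAlgebra.antipode R (r.right i)) := by
  simp only [← ev_apply]
  induction t with
  | zero => simp only [map_zero, Finset.sum_const_zero]
  | tmul f g => simp [mul_apply _ _ r, antipodeHom_apply]
  | add s t hs ht => simp only [map_add, hs, ht, Finset.sum_add_distrib]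

variable (h) in
/-- The Hopf algebra structure of `H°`. -/
@[reducible]
noncomputable def hopfAlgebra : HopfAlgebra R (FiniteDual h.toIsAdmissibleBialgebra) where
  antipode := antipodeHom h
  mul_antipode_rTensor_comul := LinearMap.ext fun f => by
    ext a
    simp only [LinearMap.comp_apply]
    rw [mul'_rTensor_antipodeHom_apply (ℛ R a), comul_eq, Algebra.linearMap_apply,
      algebraMap_apply, counit_eq]
    simp only [evLeft_comulHom, translate_apply]
    rw [← map_sum, HopfAlgebra.sum_antipode_mul_eq_smul, map_smul, smul_eq_mul, mul_comm]
  mul_antipode_lTensor_comul := LinearMap.ext fun f => by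
    ext a
    simp only [LinearMap.comp_apply]
    rw [mul'_lTensor_antipodeHom_apply (ℛ R a), comul_eq, Algebra.linearMap_apply,
      algebraMap_apply, counit_eq]
    simp only [evLeft_comulHom, translate_apply]
    rw [← map_sum, HopfAlgebra.sum_mul_antipode_eq_smul, map_smul, smul_eq_mul, mul_comm]

theorem isDualHopfAlgebra (h : IsAdmissibleHopfAlgebra R H) :
    IsDualHopfAlgebra h.toIsAdmissibleBialgebra (hopfAlgebra h) where
  toIsDualBialgebra := isDualBialgebra h.toIsAdmissibleBialgebra
  antipode_apply _ _ := rfl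

end HopfAlgebra

end FiniteDual

theorem mainTheorem3 (R : Type u) [CommRing R] (k : ℕ) :
    (∃ h : IsAdmissibleBialgebra R (GroupLikePolynomial R k),
      ∃ B : Bialgebra R (FiniteDual h), FiniteDual.IsDualBialgebra h B) ∧
    (∃ h : IsAdmissibleHopfAlgebra R (PrimitivePolynomial R k),
      ∃ B : HopfAlgebra R (FiniteDual h.toIsAdmissibleBialgebra),
        FiniteDual.IsDualHopfAlgebra h.toIsAdmissibleBialgebra B) :=
  ⟨⟨(MvPolynomial.isCofinitary R k).isAdmissibleBialgebra, _, FiniteDual.isDualBialgebra _⟩,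
    ⟨(PrimitivePolynomial.isCofinitary R k).isAdmissibleHopfAlgebra, _,
      FiniteDual.isDualHopfAlgebra (PrimitivePolynomial.isCofinitary R k).isAdmissibleHopfAlgebra⟩⟩
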